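/- Let $W(\mathbf{Z})$ be the group (under composition) of all bijections $g$ of $\mathbf{Z}$ for which $\sup\{|g(j)-j| : j\in\mathbf{Z}\}$ is finite, acting on the collection $\mathscr{P}_{\mathrm f}(\mathbf{Z})$ of all finite subsets of $\mathbf{Z}$ by $g\cdot E=\{g(j): j\in E\}$. Then this action admits an invariant mean which gives full weight to the collection of sets containing $0$. That is, there is a positive linear functional $m\colon \ell^\infty(\mathscr{P}_{\mathrm f}(\mathbf{Z}))\to\mathbf{R}$ with $m(1)=1$ such that $m(g\cdot f)=m(f)$ for all $g\in W(\mathbf{Z})$ and all bounded $f\colon\mathscr{P}_{\mathrm f}(\mathbf{Z})\to\mathbf{R}$, where $(g\cdot f)(E)=f(g^{-1}\cdot E)$, and such that $m(\mathbf{1}_{\{E\,:\,0\in E\}})=1$. -/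

import Mathlib

open scoped ENNReal Pointwise

/-- The group `W(ℤ)` of piecewise-translations of the integers: all bijections `g` of `ℤ` for
which `sup {|g j - j| : j ∈ ℤ}` is finite. -/
def piecewiseTranslations : Subgroup (Equiv.Perm ℤ) where
  carrier := {g | BddAbove (Set.range fun j : ℤ => |g j - j|)}
  one_mem' := ⟨0, by rintro _ ⟨j, rfl⟩; simp⟩
  mul_mem' := by
    rintro g h ⟨a, ha⟩ ⟨b, hb⟩
    refine ⟨a + b, ?_⟩
    rintro _ ⟨j, rfl⟩
    have h1 := ha ⟨h j, rfl⟩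
    have h2 := hb ⟨j, rfl⟩
    simp only [Equiv.Perm.mul_apply]
    exact (abs_sub_le _ (h j) _).trans (add_le_add h1 h2)
  inv_mem' := by
    rintro g ⟨a, ha⟩
    refine ⟨a, ?_⟩
    rintro _ ⟨j, rfl⟩
    have h1 := ha ⟨g⁻¹ j, rfl⟩
    simpa [abs_sub_comm] using h1

/-- The space `ℓ^∞(X)` of bounded real-valued functions on a set `X`. -/
abbrev BoundedFun (X : Type*) : Type _ := lp (fun _ : X => ℝ) ∞

namespace BoundedFun

/-- The bounded function on `X` with value `1` on `A` and `0` off `A`. -/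
noncomputable def indicator {X : Type*} (A : Set X) : BoundedFun X :=
  ⟨A.indicator fun _ => 1, by
    classical
    refine memℓp_infty ⟨1, ?_⟩
    rintro _ ⟨x, rfl⟩
    simp only [Set.indicator_apply]
    split_ifs <;> simp⟩

/-- The translate `g f` of a bounded function `f` under a group acting on `X`:
`(g f)(x) = f(g⁻¹ x)`. -/
def translate {G X : Type*} [Group G] [MulAction G X] (g : G) (f : BoundedFun X) :
    BoundedFun X :=
  ⟨fun x => f (g⁻¹ • x), by
    obtain ⟨C, hC⟩ := memℓp_infty_iff.1 (lp.memℓp f)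
    refine memℓp_infty ⟨C, ?_⟩
    rintro _ ⟨x, rfl⟩
    exact hC ⟨g⁻¹ • x, rfl⟩⟩

end BoundedFun

/-- A mean on a set `X`: a positive normalised linear functional on `ℓ^∞(X)`. -/
structure SetMean (X : Type*) where
  toLinearMap : BoundedFun X →ₗ[ℝ] ℝ
  nonneg : ∀ f : BoundedFun X, (∀ x, 0 ≤ f x) → 0 ≤ toLinearMap f
  map_one : toLinearMap (BoundedFun.indicator Set.univ) = 1

namespace SetMean

/-- The weight that a mean gives to a collection `A ⊆ X`: its value at the characteristic
function of `A`. -/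
noncomputable def weight {X : Type*} (m : SetMean X) (A : Set X) : ℝ :=
  m.toLinearMap (BoundedFun.indicator A)

/-- Invariance of a mean on `X` under a group `G` acting on `X`. -/
def IsInvariant (G : Type*) {X : Type*} [Group G] [MulAction G X] (m : SetMean X) : Prop :=
  ∀ (g : G) (f : BoundedFun X), m.toLinearMap (BoundedFun.translate g f) = m.toLinearMap f

end SetMean

/-! Let a random finite set contain each `j` independently with probability `sin² θ(j)`, where `θ`
is a wide tent with peak `π / 2` at `0`; then it almost surely contains `0`. The square roots of the
law form a product of unit vectors `(cos θ(j), sin θ(j))`, so two such laws have overlap `∏ cos(θ(j)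
- η(j)) ≥ 1 - ½ ∑ (θ(j) - η(j))²`, and are close in total variation when the angles are close in
`ℓ²`. A permutation moving points by at most `K` changes a tent of width `n` by `O(K/n)` at `O(n +
K)` points, a squared distance tending to `0`. An ultralimit of these laws is therefore invariant.
-/

open Filter Topology

/-- The mean given by a finitely supported probability weight. -/
noncomputable def SetMean.ofWeights {X : Type*} (P : Finset X) (w : X → ℝ)
    (hw : ∀ x, 0 ≤ w x) (hP : ∑ x ∈ P, w x = 1) : SetMean X where
  toLinearMap :=
    { toFun := fun f => ∑ x ∈ P, w x * f x
      map_add' := fun f g => by simp [mul_add, Finset.sum_add_distrib]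
      map_smul' := fun c f => by
        simp only [lp.coeFn_smul, Pi.smul_apply, smul_eq_mul, RingHom.id_apply, Finset.mul_sum]
        exact Finset.sum_congr rfl fun _ _ => by ring }
  nonneg := fun f hf => Finset.sum_nonneg fun x _ => mul_nonneg (hw x) (hf x)
  map_one := by simpa [BoundedFun.indicator] using hP

theorem BoundedFun.exists_abs_le {X : Type*} (f : BoundedFun X) :
    ∃ C, 0 ≤ C ∧ ∀ x, |f x| ≤ C := by
  obtain ⟨C, hC⟩ := memℓp_infty_iff.1 (lp.memℓp f)
  exact ⟨max C 0, le_max_right _ _, fun x => (hC ⟨x, rfl⟩).trans (le_max_left _ _)⟩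

theorem SetMean.exists_abs_le {X : Type*} (f : BoundedFun X) :
    ∃ C, ∀ m : SetMean X, |m.toLinearMap f| ≤ C := by
  obtain ⟨C, -, hC⟩ := f.exists_abs_le
  refine ⟨C, fun m => ?_⟩
  have h1 := m.nonneg (C • BoundedFun.indicator Set.univ - f) fun x => by
    rw [lp.coeFn_sub, lp.coeFn_smul]
    simpa [BoundedFun.indicator] using (abs_le.1 (hC x)).2
  have h2 := m.nonneg (C • BoundedFun.indicator Set.univ + f) fun x => by
    have := (abs_le.1 (hC x)).1
    rw [lp.coeFn_add, lp.coeFn_smul]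
    simp only [BoundedFun.indicator, Set.indicator_univ, Pi.add_apply, Pi.smul_apply, smul_eq_mul,
      mul_one]
    linarith
  simp only [map_sub, map_add, map_smul, m.map_one, smul_eq_mul, mul_one] at h1 h2
  exact abs_le.2 ⟨by linarith, by linarith⟩

/-- Weak-star compactness of the set of means. -/
theorem SetMean.exists_tendsto_ultrafilter {X ι : Type*} (U : Ultrafilter ι) (m : ι → SetMean X) :
    ∃ μ : SetMean X, ∀ f, Tendsto (fun i => (m i).toLinearMap f) U (𝓝 (μ.toLinearMap f)) := by
  have h : ∀ f, ∃ a, Tendsto (fun i => (m i).toLinearMap f) U (𝓝 a) := fun f => by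
    obtain ⟨C, hC⟩ := SetMean.exists_abs_le f
    obtain ⟨a, -, ha⟩ := (isCompact_Icc (a := -C) (b := C)).ultrafilter_le_nhds
      (U.map fun i => (m i).toLinearMap f)
      (tendsto_principal.2 (Eventually.of_forall fun i => abs_le.1 (hC (m i))))
    exact ⟨a, ha⟩
  choose L hL using h
  refine ⟨⟨⟨⟨L, fun f g => ?_⟩, fun c f => ?_⟩, fun f hf => ?_, ?_⟩, hL⟩
  · exact tendsto_nhds_unique (hL _) (by simpa using (hL f).add (hL g))
  · exact tendsto_nhds_unique (hL _) (by simpa using (hL f).const_mul c)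
  · exact ge_of_tendsto' (hL f) fun i => (m i).nonneg f hf
  · exact tendsto_nhds_unique (hL _) (by simp [(m _).map_one])

/-- The amplitude at `E` of the product over `j` of the unit vectors `(cos (θ j), sin (θ j))`. -/
noncomputable def amplitude (θ : ℤ → ℝ) (E : Finset ℤ) : ℝ :=
  ∏ᶠ j, if j ∈ E then Real.sin (θ j) else Real.cos (θ j)

section amplitude

variable {θ η : ℤ → ℝ} {F E : Finset ℤ}

theorem amplitude_eq_prod (hF : ∀ j ∉ F, θ j = 0) (hE : E ⊆ F) :
    amplitude θ E = ∏ j ∈ F, if j ∈ E then Real.sin (θ j) else Real.cos (θ j) := by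
  refine finprod_eq_prod_of_mulSupport_subset _ fun j hj => ?_
  by_contra hjF
  have hjF : j ∉ F := hjF
  exact hj (by simp [hF j hjF, mt (@hE j) hjF])

theorem amplitude_eq_zero (hF : ∀ j ∉ F, θ j = 0) (hE : ¬E ⊆ F) : amplitude θ E = 0 := by
  obtain ⟨j, hjE, hjF⟩ := Finset.not_subset.1 hE
  -- A zero factor kills a `finprod` only when finitely many factors differ from `1`; off `F ∪ E`
  -- each is `cos 0`.
  refine finprod_eq_zero _ j (by simp [hjE, hF j hjF]) ((F ∪ E).finite_toSet.subset fun i hi => ?_)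
  by_contra h
  simp only [Finset.coe_union, Set.mem_union, Finset.mem_coe, not_or] at h
  exact hi (by simp [h.2, hF i h.1])

theorem amplitude_comp (g : Equiv.Perm ℤ) : amplitude (θ ∘ g) E = amplitude θ (g • E) := by
  unfold amplitude
  rw [← finprod_comp_equiv g (f := fun j => if j ∈ g • E then _ else _)]
  refine finprod_congr fun j => ?_
  have : g j ∈ g • E ↔ j ∈ E := Finset.smul_mem_smul_finset_iff g
  simp [this]

/-- Expanding `∏ (sin θ sin η + cos θ cos η)` gives one term per subset of `F`. -/
theorem sum_amplitude_mul (hθ : ∀ j ∉ F, θ j = 0) (hη : ∀ j ∉ F, η j = 0) :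
    ∑ E ∈ F.powerset, amplitude θ E * amplitude η E = ∏ j ∈ F, Real.cos (θ j - η j) := by
  simp only [Real.cos_sub, add_comm (Real.cos _ * _)]
  rw [Finset.prod_add]
  refine Finset.sum_congr rfl fun E hE => ?_
  have hE := Finset.mem_powerset.1 hE
  rw [amplitude_eq_prod hθ hE, amplitude_eq_prod hη hE, ← Finset.prod_mul_distrib,
    ← Finset.prod_sdiff hE, mul_comm]
  congr 1
  · exact Finset.prod_congr rfl fun j hj => by simp [hj]
  · exact Finset.prod_congr rfl fun j hj => by simp [(Finset.mem_sdiff.1 hj).2]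

theorem sum_amplitude_sq (hθ : ∀ j ∉ F, θ j = 0) :
    ∑ E ∈ F.powerset, amplitude θ E ^ 2 = 1 := by
  simpa [sq] using sum_amplitude_mul hθ hθ

theorem finsum_amplitude_sq_mul (hθ : ∀ j ∉ F, θ j = 0) (f : Finset ℤ → ℝ) :
    ∑ᶠ E, amplitude θ E ^ 2 * f E = ∑ E ∈ F.powerset, amplitude θ E ^ 2 * f E := by
  refine finsum_eq_sum_of_support_subset _ fun E hE => ?_
  by_contra h
  exact hE (by simp [amplitude_eq_zero hθ (fun hEF => h (by simpa using hEF))])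

theorem finsum_amplitude_sq_mul_comp (g : Equiv.Perm ℤ) (f : Finset ℤ → ℝ) :
    ∑ᶠ E, amplitude θ E ^ 2 * f (g⁻¹ • E) = ∑ᶠ E, amplitude (θ ∘ g) E ^ 2 * f E := by
  rw [← finsum_comp_equiv (MulAction.toPerm g)]
  exact finsum_congr fun E => by simp [amplitude_comp]

theorem one_sub_prod_cos_le {δ : ℤ → ℝ} (hδ : ∀ j, |δ j| ≤ Real.pi / 2) :
    1 - ∏ j ∈ F, Real.cos (δ j) ≤ (∑ j ∈ F, δ j ^ 2) / 2 := by
  have hc : ∀ j, 0 ≤ Real.cos (δ j) := fun j =>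
    Real.cos_nonneg_of_mem_Icc ⟨by linarith [(abs_le.1 (hδ j)).1], (abs_le.1 (hδ j)).2⟩
  induction F using Finset.induction_on with
  | empty => simp
  | insert a s ha ih =>
    rw [Finset.prod_insert ha, Finset.sum_insert ha]
    have h1 : ∏ j ∈ s, Real.cos (δ j) ≤ 1 :=
      Finset.prod_le_one (fun j _ => hc j) fun j _ => Real.cos_le_one _
    -- With `c` the new cosine and `p` the old product, `1 - c p = (1 - c) + c (1 - p) ≤ (1 - c) +
    -- (1 - p)`.
    nlinarith [Real.one_sub_sq_div_two_le_cos (x := δ a), Real.cos_le_one (δ a), hc a]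

/-- The distributions attached to two angle functions are close in total variation when the
angle functions are close in `ℓ²`. -/
theorem abs_sum_amplitude_sq_sub_le (hθ : ∀ j ∉ F, θ j = 0) (hη : ∀ j ∉ F, η j = 0)
    (hδ : ∀ j, |θ j - η j| ≤ Real.pi / 2) {f : Finset ℤ → ℝ} {C : ℝ} (hC : 0 ≤ C)
    (hf : ∀ E, |f E| ≤ C) :
    |∑ E ∈ F.powerset, amplitude θ E ^ 2 * f E - ∑ E ∈ F.powerset, amplitude η E ^ 2 * f E| ≤
      C * √(4 * ∑ j ∈ F, (θ j - η j) ^ 2) := by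
  set u := amplitude θ
  set v := amplitude η
  set P := F.powerset
  have hu : ∑ E ∈ P, u E ^ 2 = 1 := sum_amplitude_sq hθ
  have hv : ∑ E ∈ P, v E ^ 2 = 1 := sum_amplitude_sq hη
  have huv : ∑ E ∈ P, u E * v E = ∏ j ∈ F, Real.cos (θ j - η j) := sum_amplitude_mul hθ hη
  have hc := one_sub_prod_cos_le (F := F) hδ
  rw [← huv] at hc
  have hm : ∑ E ∈ P, |u E - v E| ^ 2 = 2 - 2 * ∑ E ∈ P, u E * v E := by
    simp only [sq_abs, sub_sq, Finset.sum_add_distrib, Finset.sum_sub_distrib, hu, hv, mul_assoc,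
      ← Finset.mul_sum]
    ring
  have hp : ∑ E ∈ P, |u E + v E| ^ 2 = 2 + 2 * ∑ E ∈ P, u E * v E := by
    simp only [sq_abs, add_sq, Finset.sum_add_distrib, hu, hv, mul_assoc, ← Finset.mul_sum]
    ring
  have hm0 : 0 ≤ ∑ E ∈ P, |u E - v E| ^ 2 := Finset.sum_nonneg fun _ _ => sq_nonneg _
  -- Cauchy–Schwarz: with `s = ∑ u v ≤ 1`, the product of the squared norms is `4 (1 - s) (1 + s) ≤
  -- 8 (1 - s)`.
  have key : ∑ E ∈ P, |u E - v E| * |u E + v E| ≤ √(4 * ∑ j ∈ F, (θ j - η j) ^ 2) := by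
    refine Real.le_sqrt_of_sq_le ((Finset.sum_mul_sq_le_sq_mul_sq _ _ _).trans ?_)
    rw [hm, hp] at *
    nlinarith
  calc _ = |∑ E ∈ P, (u E ^ 2 - v E ^ 2) * f E| := by
        rw [← Finset.sum_sub_distrib]; simp only [sub_mul]
    _ ≤ ∑ E ∈ P, |(u E ^ 2 - v E ^ 2) * f E| := Finset.abs_sum_le_sum_abs _ _
    _ ≤ ∑ E ∈ P, C * (|u E - v E| * |u E + v E|) := Finset.sum_le_sum fun E _ => by
        rw [sq_sub_sq, abs_mul, abs_mul, mul_comm C, mul_comm |u E - v E|]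
        exact mul_le_mul_of_nonneg_left (hf E) (by positivity)
    _ ≤ _ := by
        rw [← Finset.mul_sum]
        exact mul_le_mul_of_nonneg_left key hC

end amplitude

/-- The tent function of height `π / 2` supported on `(-(n + 1), n + 1)`. -/
noncomputable def tent (n : ℕ) (j : ℤ) : ℝ :=
  Real.pi / 2 * max (1 - |(j : ℝ)| / (n + 1)) 0

theorem tent_zero (n : ℕ) : tent n 0 = Real.pi / 2 := by simp [tent]

theorem tent_eq_zero {n : ℕ} {j : ℤ} (h : (n : ℤ) + 1 ≤ |j|) : tent n j = 0 := by
  have h' : (n : ℝ) + 1 ≤ |(j : ℝ)| := by exact_mod_cast h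
  have : 1 ≤ |(j : ℝ)| / (n + 1) := (one_le_div (by positivity)).2 h'
  simp [tent, max_eq_right (sub_nonpos.2 this)]

theorem tent_nonneg (n : ℕ) (j : ℤ) : 0 ≤ tent n j :=
  mul_nonneg (by positivity) (le_max_right _ _)

theorem tent_le (n : ℕ) (j : ℤ) : tent n j ≤ Real.pi / 2 :=
  mul_le_of_le_one_right (by positivity)
    (max_le (sub_le_self _ (by positivity)) zero_le_one)

theorem abs_tent_sub_tent_le (n : ℕ) (i j : ℤ) :
    |tent n i - tent n j| ≤ Real.pi / 2 * (|((i - j : ℤ) : ℝ)| / (n + 1)) := by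
  rw [tent, tent, ← mul_sub, abs_mul, abs_of_pos (by positivity : 0 < Real.pi / 2)]
  gcongr
  refine (abs_max_sub_max_le_abs _ _ _).trans ?_
  rw [sub_sub_sub_cancel_left, ← sub_div, abs_div, abs_of_pos (by positivity : 0 < (n : ℝ) + 1),
    abs_sub_comm, Int.cast_sub]
  exact div_le_div_of_nonneg_right (abs_abs_sub_abs_le (i : ℝ) j) (by positivity)

theorem tent_eq_zero_of_notMem {n K : ℕ} {j : ℤ}
    (h : j ∉ Finset.Icc (-((n : ℤ) + 1 + K)) ((n : ℤ) + 1 + K)) : tent n j = 0 := by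
  refine tent_eq_zero ?_
  rw [Finset.mem_Icc, ← abs_le] at h
  omega

/-- The law of the random finite set that contains each `j` independently with probability
`sin (tent n j) ^ 2`. -/
noncomputable def tentMean (n : ℕ) : SetMean (Finset ℤ) :=
  SetMean.ofWeights (Finset.Icc (-((n : ℤ) + 1 + (0 : ℕ))) ((n : ℤ) + 1 + (0 : ℕ))).powerset
    (fun E => amplitude (tent n) E ^ 2) (fun _ => sq_nonneg _)
    (sum_amplitude_sq fun _ => tent_eq_zero_of_notMem)

theorem tentMean_apply (n : ℕ) (f : BoundedFun (Finset ℤ)) :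
    (tentMean n).toLinearMap f = ∑ᶠ E, amplitude (tent n) E ^ 2 * f E := by
  rw [finsum_amplitude_sq_mul fun _ => tent_eq_zero_of_notMem (K := 0)]
  rfl

theorem tentMean_weight (n : ℕ) : (tentMean n).weight {E | (0 : ℤ) ∈ E} = 1 := by
  rw [SetMean.weight, ← (tentMean n).map_one, tentMean_apply, tentMean_apply]
  refine finsum_congr fun E => ?_
  by_cases h : (0 : ℤ) ∈ E
  · simp [BoundedFun.indicator, h]
  · have : amplitude (tent n) E = 0 := by
      refine finprod_eq_zero _ 0 (by simp [h, tent_zero]) ?_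
      refine (Finset.Icc (-((n : ℤ) + 1 + (0 : ℕ))) ((n : ℤ) + 1 + (0 : ℕ)) ∪ E).finite_toSet.subset
        fun i hi => ?_
      by_contra hiF
      simp only [Finset.coe_union, Set.mem_union, Finset.mem_coe, not_or] at hiF
      exact hi (by simp [hiF.2, tent_eq_zero_of_notMem hiF.1])
    simp [this]

theorem abs_tentMean_translate_sub_le (n K : ℕ) (g : piecewiseTranslations)
    (hg : ∀ j, |g.1 j - j| ≤ K) {f : BoundedFun (Finset ℤ)} {C : ℝ} (hC : 0 ≤ C)
    (hf : ∀ E, |f E| ≤ C) :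
    |(tentMean n).toLinearMap (BoundedFun.translate g f) - (tentMean n).toLinearMap f| ≤
      C * √(4 * ((2 * (n + 1 + K) + 1) * (Real.pi / 2 * (K / (n + 1))) ^ 2)) := by
  -- The margin `K` makes one window contain the supports of both the tent and its translate.
  have h0 : ∀ j ∉ Finset.Icc (-((n : ℤ) + 1 + K)) ((n : ℤ) + 1 + K), tent n j = 0 :=
    fun _ => tent_eq_zero_of_notMem
  have h1 : ∀ j ∉ Finset.Icc (-((n : ℤ) + 1 + K)) ((n : ℤ) + 1 + K), (tent n ∘ g.1) j = 0 :=
    fun j hj => by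
      refine tent_eq_zero ?_
      rw [Finset.mem_Icc, ← abs_le] at hj
      have := abs_sub_abs_le_abs_sub j (g.1 j)
      rw [abs_sub_comm j] at this
      linarith [hg j]
  have ht : (tentMean n).toLinearMap (BoundedFun.translate g f) =
      ∑ᶠ E, amplitude (tent n ∘ g.1) E ^ 2 * f E := by
    rw [tentMean_apply]
    exact finsum_amplitude_sq_mul_comp g.1 f
  rw [ht, tentMean_apply, finsum_amplitude_sq_mul h1, finsum_amplitude_sq_mul h0]
  refine (abs_sum_amplitude_sq_sub_le h1 h0 (fun j => ?_) hC hf).trans ?_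
  · have := tent_nonneg n j
    have := tent_nonneg n (g.1 j)
    have := tent_le n j
    have := tent_le n (g.1 j)
    exact abs_le.2 ⟨by simp only [Function.comp]; linarith, by simp only [Function.comp]; linarith⟩
  · gcongr
    refine (Finset.sum_le_card_nsmul _ _ ((Real.pi / 2 * (K / (n + 1))) ^ 2) fun j _ => ?_).trans ?_
    · rw [← sq_abs]
      gcongr
      refine (abs_tent_sub_tent_le n (g.1 j) j).trans ?_
      gcongr
      exact_mod_cast hg j
    · rw [nsmul_eq_mul]
      gcongr
      rw [Int.card_Icc]
      have : ((n : ℤ) + 1 + K + 1 - -((n : ℤ) + 1 + K)).toNat = 2 * (n + 1 + K) + 1 := by omega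
      rw [this]
      push_cast
      exact le_rfl

theorem tendsto_tentMean_translate_sub (g : piecewiseTranslations) (f : BoundedFun (Finset ℤ)) :
    Tendsto (fun n => (tentMean n).toLinearMap (BoundedFun.translate g f) -
      (tentMean n).toLinearMap f) atTop (𝓝 0) := by
  obtain ⟨C, hC, hf⟩ := f.exists_abs_le
  obtain ⟨B, hB⟩ := g.2
  have hg : ∀ j, |g.1 j - j| ≤ (B.toNat : ℤ) := fun j => (hB ⟨j, rfl⟩).trans (Int.self_le_toNat B)
  generalize B.toNat = K at hg
  refine squeeze_zero_norm (fun n => abs_tentMean_translate_sub_le n K g hg hC hf) ?_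
  have hx : Tendsto (fun n : ℕ => 1 / ((n : ℝ) + 1)) atTop (𝓝 0) :=
    tendsto_one_div_add_atTop_nhds_zero_nat
  -- The bound in terms of `x = 1 / (n + 1)`: continuous and zero at `x = 0`.
  have hcont : Continuous fun x : ℝ =>
      C * √(4 * ((2 + (2 * K + 1) * x) * (Real.pi / 2 * K) ^ 2 * x)) := by fun_prop
  have := (hcont.tendsto 0).comp hx
  simp only [mul_zero, Real.sqrt_zero] at this
  refine this.congr fun n => ?_
  simp only [Function.comp]
  congr 3
  field_simp
  ring

theorem theoremB :
    ∃ m : SetMean (Finset ℤ),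
      m.IsInvariant piecewiseTranslations ∧ m.weight {E : Finset ℤ | (0 : ℤ) ∈ E} = 1 := by
  obtain ⟨m, hm⟩ := SetMean.exists_tendsto_ultrafilter (hyperfilter ℕ) tentMean
  refine ⟨m, fun g f => ?_, ?_⟩
  · have h := (tendsto_tentMean_translate_sub g f).mono_left Nat.hyperfilter_le_atTop
    exact sub_eq_zero.1 (tendsto_nhds_unique ((hm _).sub (hm f)) h)
  · exact tendsto_nhds_unique (hm _) (tendsto_const_nhds.congr fun n => (tentMean_weight n).symm)
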